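/- Let $\Gamma$ be a finite connected graph (loops and multiple edges allowed), let $f\colon\Gamma\to\Gamma$ be a homotopy equivalence that sends vertices to vertices and each edge across an edge-path, let $*$ be a vertex with $f(*)=*$, and let $H\subseteq\Gamma$ be a subgraph with $f(H)\subseteq H$. Put $\mathbb F=\pi_1(\Gamma,*)$, let $\Phi_f\in\mathrm{Aut}(\mathbb F)$ be the automorphism induced by $f$, and let $G_\phi=\mathbb F\rtimes_{\Phi_f}\langle t\rangle=\langle \mathbb F,t\mid t^{-1}xt=\Phi_f(x)\ (x\in\mathbb F)\rangle$. Let $\widetilde\Gamma$ be the universal cover of $\Gamma$, let $\widetilde H$ be the preimage of $H$, let $\tilde f$ be the lift of $f$ that fixes a chosen lift of $*$, let $C_1(\widetilde\Gamma,\widetilde H;\mathbb Q)$ be the $\mathbb Q[\mathbb F]$-module of rational cellular $1$-chains of $\widetilde\Gamma$ whose coefficients vanish on the edges of $\widetilde H$, and let $\pi_H^\perp$ be the projection of $C_1(\widetilde\Gamma;\mathbb Q)$ onto it that forgets the coefficients on the edges of $\widetilde H$. For vertices $u,v$ of $\widetilde\Gamma$ let $[u,v]$ be the unique $1$-chain with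 boundary $v-u$. A *Nielsen $1$-chain* is a chain $\rho=\pi_H^\perp([u,v])$, where $\tilde f(u)=u$ and $\tilde f(v)=v$, that is non-geometric or geometric. It is *non-geometric* if there is an edge $e$ of $\widetilde\Gamma$ outside $\widetilde H$ with $\rho_e=\pm1$ and $\rho_{ge}=0$ for all $1\neq g\in\mathbb F$. It is *geometric* if (i) for distinct $g_1,g_2\in\mathbb F$ the set $\mathrm{supp}(g_1\rho)\cap\mathrm{supp}(g_2\rho)$ is empty or a single edge; (ii) for each edge $e$ of $\widetilde\Gamma$ outside $\widetilde H$ there is exactly one unordered pair of distinct elements $g_1,g_2\in\mathbb F$ with $\mathrm{supp}(g_1\rho)\cap\mathrm{supp}(g_2\rho)=\{e\}$; (iii) there are non-commuting $g_1,g_2\in\mathbb F$ such that $\mathrm{supp}(\rho)$ meets both $\mathrm{supp}(g_1\rho)$ and $\mathrm{supp}(g_2\rho)$. Let $V_{\rm qf}\subseteq C_1(\widetilde\Gamma,\widetilde H;\mathbb Q)$ be a $\mathbb Q[\mathbb F]$-submodule that is zero or generated by a Nielsen $1$-chain. Let $n_H$ be the number of edges of $\Gamma$ outside $H$. A choice of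 one lift to $\widetilde\Gamma$ of each of these edges identifies $C_1(\widetilde\Gamma,\widetilde H;\mathbb Q)$ with $\mathbb Q[\mathbb F]^{n_H}\subseteq L^2(\mathbb F)^{n_H}\subseteq L^2(G_\phi)^{n_H}$. Let $V_{\rm qf}^{(2)}$ be the closure in $L^2(\mathbb F)^{n_H}$ of the complex span of $V_{\rm qf}$, and let $W_{\rm qf}^{(2)}=\iota_*V_{\rm qf}^{(2)}$ be the closure in $L^2(G_\phi)^{n_H}$ of $\bigoplus_{\ell\in\mathbb Z}t^\ell V_{\rm qf}^{(2)}$. If $W_{\rm qf}^{(2)}\neq\{0\}$, then $W_{\rm qf}^{(2)}$ is isomorphic to $L^2(G_\phi)$ as a Hilbert-$G_\phi$-module, that is, there is a $G_\phi$-equivariant bounded linear bijection $L^2(G_\phi)\to W_{\rm qf}^{(2)}$ with bounded inverse. Moreover, if $\rho$ is a Nielsen $1$-chain that generates $V_{\rm qf}$, then the map $\mathbb Q[\mathbb F]\to V_{\rm qf}$, $q\mapsto q\rho$, extends to an $\mathbb F$-equivariant bounded linear bijection $O\colon L^2(\mathbb F)\to V_{\rm qf}^{(2)}$ with bounded inverse,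 and there is a constant $D\ge1$ with $D^{-1}\|\xi\|\le\|O(\xi)\|\le D\|\xi\|$ for all $\xi\in L^2(\mathbb F)$. -/

import Mathlib

/-! ### Graphs, edge-paths and the fundamental group -/

/-- A graph (1-dimensional CW-complex) with vertex set `V` and edge set `E`; each edge `e` is
oriented, with initial vertex `o e` and terminal vertex `t e`. Loops and multiple edges are
allowed. -/
structure CellGraph (V E : Type*) where
  o : E → V
  t : E → V

namespace CellGraph

variable {V E : Type*} (Γ : CellGraph V E)

/-- Initial vertex of an oriented edge: `(e, true)` is `e`, `(e, false)` is the reversed edge. -/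
def src (x : E × Bool) : V := if x.2 then Γ.o x.1 else Γ.t x.1

/-- Terminal vertex of an oriented edge. -/
def tgt (x : E × Bool) : V := if x.2 then Γ.t x.1 else Γ.o x.1

/-- `Γ.IsEdgePath a L b`: the list `L` of oriented edges is an edge-path from `a` to `b`
(not necessarily reduced, possibly trivial). -/
def IsEdgePath : V → List (E × Bool) → V → Prop
  | a, [], b => a = b
  | a, x :: L, b => Γ.src x = a ∧ IsEdgePath (Γ.tgt x) L b

/-- `Γ` is connected (and non-empty as soon as a base vertex is given). -/
def Connected : Prop := ∀ a b, ∃ L, Γ.IsEdgePath a L b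

/-- The homotopy classes, relative to the endpoints, of edge-paths from `a` to `b`. Two edge-paths
with the same endpoints are homotopic if and only if they become equal after cancelling
backtracks, that is, if and only if they define the same element of the free group on `E`; the
class of an edge-path is recorded as that element. -/
def PathClass (a b : V) : Set (FreeGroup E) :=
  {w | ∃ L, Γ.IsEdgePath a L b ∧ FreeGroup.mk L = w}

variable {Γ}

theorem IsEdgePath.append {a b c : V} {L M : List (E × Bool)} (h : Γ.IsEdgePath a L b)
    (h' : Γ.IsEdgePath b M c) : Γ.IsEdgePath a (L ++ M) c := by
  induction L generalizing a with
  | nil => cases h; exact h'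
  | cons x L ih => exact ⟨h.1, ih h.2⟩

theorem IsEdgePath.invRev {a b : V} {L : List (E × Bool)} (h : Γ.IsEdgePath a L b) :
    Γ.IsEdgePath b (FreeGroup.invRev L) a := by
  induction L generalizing a with
  | nil => cases h; rfl
  | cons x L ih =>
    have h1 : FreeGroup.invRev (x :: L) = FreeGroup.invRev L ++ [(x.1, !x.2)] := by
      simp [FreeGroup.invRev]
    rw [h1]
    refine (ih h.2).append ⟨?_, ?_⟩
    · rcases x with ⟨e, _ | _⟩ <;> rfl
    · have := h.1
      rcases x with ⟨e, _ | _⟩ <;> exact this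

theorem PathClass.one_mem (a : V) : (1 : FreeGroup E) ∈ Γ.PathClass a a := ⟨[], rfl, rfl⟩

theorem PathClass.mul_mem {a b c : V} {w z : FreeGroup E} (hw : w ∈ Γ.PathClass a b)
    (hz : z ∈ Γ.PathClass b c) : w * z ∈ Γ.PathClass a c := by
  obtain ⟨L, hL, rfl⟩ := hw
  obtain ⟨M, hM, rfl⟩ := hz
  exact ⟨L ++ M, hL.append hM, FreeGroup.mul_mk.symm⟩

theorem PathClass.inv_mem {a b : V} {w : FreeGroup E} (hw : w ∈ Γ.PathClass a b) :
    w⁻¹ ∈ Γ.PathClass b a := by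
  obtain ⟨L, hL, rfl⟩ := hw
  exact ⟨FreeGroup.invRev L, hL.invRev, FreeGroup.inv_mk.symm⟩

theorem PathClass.edge_mem (e : E) : FreeGroup.of e ∈ Γ.PathClass (Γ.o e) (Γ.t e) :=
  ⟨[(e, true)], ⟨rfl, rfl⟩, rfl⟩

variable (Γ)

/-- The fundamental group of `Γ` at `a`: homotopy classes of closed edge-paths at `a`, multiplied
by concatenation. -/
def π₁ (a : V) : Subgroup (FreeGroup E) where
  carrier := Γ.PathClass a a
  mul_mem' := PathClass.mul_mem
  one_mem' := PathClass.one_mem a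
  inv_mem' := PathClass.inv_mem

/-- A subgraph: a set of vertices and a set of edges that contains the endpoints of its edges. -/
structure Subgraph where
  verts : Set V
  edges : Set E
  o_mem : ∀ e ∈ edges, Γ.o e ∈ verts
  t_mem : ∀ e ∈ edges, Γ.t e ∈ verts

/-- A cellular self-map of `Γ`, up to parametrization of the edges: vertices go to vertices, and
each edge goes across an edge-path (which may be trivial). -/
structure SelfMap where
  onV : V → V
  onE : E → List (E × Bool)
  isEdgePath : ∀ e, Γ.IsEdgePath (onV (Γ.o e)) (onE e) (onV (Γ.t e))

namespace SelfMap

variable {Γ}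

/-- The effect of a self-map on (classes of) edge-paths. -/
def onPaths (f : Γ.SelfMap) : FreeGroup E →* FreeGroup E :=
  FreeGroup.lift fun e => FreeGroup.mk (f.onE e)

theorem onPaths_mem (f : Γ.SelfMap) {a b : V} {w : FreeGroup E} (hw : w ∈ Γ.PathClass a b) :
    f.onPaths w ∈ Γ.PathClass (f.onV a) (f.onV b) := by
  obtain ⟨L, hL, rfl⟩ := hw
  induction L generalizing a with
  | nil => cases hL; exact PathClass.one_mem _
  | cons x L ih =>
    have h1 : (FreeGroup.mk (x :: L) : FreeGroup E) = FreeGroup.mk [x] * FreeGroup.mk L := by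
      rw [FreeGroup.mul_mk]; rfl
    rw [h1, map_mul]
    refine PathClass.mul_mem ?_ (ih hL.2)
    have he := PathClass.inv_mem (Γ := Γ) ⟨_, f.isEdgePath x.1, rfl⟩
    obtain ⟨rfl, -⟩ := hL
    rcases x with ⟨e, _ | _⟩
    · simpa [onPaths, src, tgt] using he
    · have he' : FreeGroup.mk (f.onE e) ∈ Γ.PathClass (f.onV (Γ.o e)) (f.onV (Γ.t e)) :=
        ⟨_, f.isEdgePath e, rfl⟩
      simpa [onPaths, src, tgt] using he'

/-- `h ∘ f` is homotopic to the identity: there are edge-paths `γ v` from `v` to `h (f v)` (the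
tracks of the vertices) such that for every edge `e` the path `h (f e)` is homotopic to
`(γ (o e))⁻¹ · e · γ (t e)`. -/
def CompHomotopicId (h f : Γ.SelfMap) : Prop :=
  ∃ γ : V → FreeGroup E, (∀ v, γ v ∈ Γ.PathClass v (h.onV (f.onV v))) ∧
    ∀ e, h.onPaths (f.onPaths (FreeGroup.of e)) = (γ (Γ.o e))⁻¹ * FreeGroup.of e * γ (Γ.t e)

/-- `f` is a homotopy equivalence. -/
def IsHomotopyEquivalence (f : Γ.SelfMap) : Prop :=
  ∃ h : Γ.SelfMap, CompHomotopicId h f ∧ CompHomotopicId f h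

theorem CompHomotopicId.exists_conj {h f : Γ.SelfMap} (H : CompHomotopicId h f) :
    ∃ γ : V → FreeGroup E, (∀ v, γ v ∈ Γ.PathClass v (h.onV (f.onV v))) ∧
      ∀ a b, ∀ w ∈ Γ.PathClass a b, h.onPaths (f.onPaths w) = (γ a)⁻¹ * w * γ b := by
  obtain ⟨γ, hγ, he⟩ := H
  refine ⟨γ, hγ, ?_⟩
  rintro a b w ⟨L, hL, rfl⟩
  induction L generalizing a with
  | nil =>
    cases hL
    rw [← FreeGroup.one_eq_mk]; simp
  | cons x L ih =>
    have h1 : (FreeGroup.mk (x :: L) : FreeGroup E) = FreeGroup.mk [x] * FreeGroup.mk L := by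
      rw [FreeGroup.mul_mk]; rfl
    obtain ⟨rfl, hL⟩ := hL
    rw [h1, map_mul, map_mul, ih _ hL]
    rcases x with ⟨e, _ | _⟩
    · have h2 : (FreeGroup.mk [(e, false)] : FreeGroup E) = (FreeGroup.of e)⁻¹ := rfl
      rw [h2, map_inv, map_inv, he e]
      simp [src, tgt, mul_assoc]
    · have h2 : (FreeGroup.mk [(e, true)] : FreeGroup E) = FreeGroup.of e := rfl
      rw [h2, he e]
      simp [src, tgt, mul_assoc]

/-- The endomorphism of the fundamental group at a fixed vertex (and the trivial path there). -/
def onπ₁ (f : Γ.SelfMap) {a : V} (ha : f.onV a = a) : Γ.π₁ a →* Γ.π₁ a where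
  toFun g := ⟨f.onPaths g, by have := f.onPaths_mem g.2; rwa [ha] at this⟩
  map_one' := by ext; simp
  map_mul' x y := by ext; simp

theorem onπ₁_bijective (f : Γ.SelfMap) (hf : f.IsHomotopyEquivalence) {a : V}
    (ha : f.onV a = a) : Function.Bijective (f.onπ₁ ha) := by
  obtain ⟨h, h1, h2⟩ := hf
  obtain ⟨γ, hγ, h1⟩ := h1.exists_conj
  obtain ⟨δ, -, h2⟩ := h2.exists_conj
  constructor
  · rw [injective_iff_map_eq_one]
    rintro ⟨w, hw⟩ hw1
    have hw1 : f.onPaths w = 1 := congrArg Subtype.val hw1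
    have h3 := h1 a a w hw
    rw [hw1, map_one] at h3
    ext
    have h4 : w = γ a * ((γ a)⁻¹ * w * γ a) * (γ a)⁻¹ := by group
    rw [← h3] at h4
    simpa using h4
  · rintro ⟨w, hw⟩
    have hw' : w ∈ Γ.PathClass (f.onV a) (f.onV a) := by rw [ha]; exact hw
    have hhw := h.onPaths_mem hw'
    have hz : γ a * h.onPaths w * (γ a)⁻¹ ∈ Γ.PathClass a a :=
      PathClass.mul_mem (PathClass.mul_mem (hγ a) hhw) (PathClass.inv_mem (hγ a))
    refine ⟨⟨_, hz⟩, ?_⟩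
    ext
    change f.onPaths _ = w
    have h3 := h1 a a _ hz
    have h4 : h.onPaths (f.onPaths (γ a * h.onPaths w * (γ a)⁻¹)) = h.onPaths w := by
      rw [h3]; group
    have hfz := f.onPaths_mem hz
    have h5 := h2 _ _ _ hfz
    rw [h4, h2 _ _ _ hw'] at h5
    exact (mul_left_cancel (mul_right_cancel h5)).symm

/-- The automorphism `Φ_f` of the fundamental group at a fixed vertex induced by a homotopy
equivalence. -/
noncomputable def inducedAut (f : Γ.SelfMap) (hf : f.IsHomotopyEquivalence) {a : V}
    (ha : f.onV a = a) : MulAut (Γ.π₁ a) :=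
  MulEquiv.ofBijective (f.onπ₁ ha) (f.onπ₁_bijective hf ha)

/-- `H` is `f`-invariant: `f H ⊆ H`. -/
def Preserves (f : Γ.SelfMap) (H : Γ.Subgraph) : Prop :=
  (∀ v ∈ H.verts, f.onV v ∈ H.verts) ∧ ∀ e ∈ H.edges, ∀ x ∈ f.onE e, x.1 ∈ H.edges

end SelfMap

/-! ### The universal cover and its cellular chains -/

/-- Vertices of the universal cover of `Γ` (based at `a`): pairs of a vertex `v` of `Γ` and a
homotopy class of edge-paths from `a` to `v`. -/
def CoverVertex (a : V) : Type _ := {x : V × FreeGroup E // x.2 ∈ Γ.PathClass a x.1}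

/-- Edges of the universal cover: pairs of an edge `e` of `Γ` and a homotopy class of edge-paths
from `a` to the initial vertex of `e`. -/
def CoverEdge (a : V) : Type _ := {x : E × FreeGroup E // x.2 ∈ Γ.PathClass a (Γ.o x.1)}

variable {Γ} {a : V}

/-- The edge of `Γ` below an edge of the universal cover. -/
def CoverEdge.proj (e : Γ.CoverEdge a) : E := e.1.1

/-- Initial vertex of an edge of the universal cover. -/
def CoverEdge.o (e : Γ.CoverEdge a) : Γ.CoverVertex a := ⟨(Γ.o e.1.1, e.1.2), e.2⟩

/-- Terminal vertex of an edge of the universal cover. -/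
def CoverEdge.t (e : Γ.CoverEdge a) : Γ.CoverVertex a :=
  ⟨(Γ.t e.1.1, e.1.2 * FreeGroup.of e.1.1), PathClass.mul_mem e.2 (PathClass.edge_mem _)⟩

/-- The deck action of the fundamental group on the edges of the universal cover. -/
instance : MulAction (Γ.π₁ a) (Γ.CoverEdge a) where
  smul g e := ⟨(e.1.1, g * e.1.2), PathClass.mul_mem g.2 e.2⟩
  one_smul _ := Subtype.ext (Prod.ext rfl (one_mul _))
  mul_smul _ _ _ := Subtype.ext (Prod.ext rfl (mul_assoc _ _ _))

/-- The action on edges is free. -/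
theorem CoverEdge.smul_left_injective (e : Γ.CoverEdge a) :
    Function.Injective fun g : Γ.π₁ a => g • e := by
  intro g h hgh
  have h1 : (g : FreeGroup E) * e.1.2 = h * e.1.2 :=
    congrArg (fun x : Γ.CoverEdge a => x.1.2) hgh
  exact Subtype.ext (mul_right_cancel h1)

/-- The lift of `f` to the universal cover that fixes the base vertex, on vertices. -/
def SelfMap.lift (f : Γ.SelfMap) (ha : f.onV a = a) (u : Γ.CoverVertex a) : Γ.CoverVertex a :=
  ⟨(f.onV u.1.1, f.onPaths u.1.2), by have := f.onPaths_mem u.2; rwa [ha] at this⟩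

variable (Γ a) in
/-- Rational cellular 1-chains of the universal cover. -/
abbrev Chain₁ : Type _ := Γ.CoverEdge a →₀ ℚ

variable (Γ a) in
/-- Rational cellular 0-chains of the universal cover. -/
abbrev Chain₀ : Type _ := Γ.CoverVertex a →₀ ℚ

/-- The cellular boundary map, `∂ e = t e - o e`. -/
noncomputable def boundary : Γ.Chain₁ a →ₗ[ℚ] Γ.Chain₀ a :=
  Finsupp.linearCombination ℚ fun e : Γ.CoverEdge a =>
    Finsupp.single e.t 1 - Finsupp.single e.o 1

/-- The translate `g x` of a 1-chain: `(g x)_{g e} = x_e`. -/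
noncomputable def translate (g : Γ.π₁ a) : Γ.Chain₁ a →ₗ[ℚ] Γ.Chain₁ a :=
  Finsupp.lmapDomain ℚ ℚ fun e : Γ.CoverEdge a => g • e

/-- The support of a 1-chain. -/
def supp (x : Γ.Chain₁ a) : Set (Γ.CoverEdge a) := {e | x e ≠ 0}

/-- The edges of the universal cover that do not lie over `H`. -/
def outside (a : V) (H : Γ.Subgraph) : Set (Γ.CoverEdge a) := {e | e.proj ∉ H.edges}

/-- The 1-chains relative to the preimage of `H`, as the chains supported outside it. -/
def relChains (a : V) (H : Γ.Subgraph) : Submodule ℚ (Γ.Chain₁ a) :=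
  Finsupp.supported ℚ ℚ (outside a H)

open Classical in
/-- The projection onto the relative 1-chains that forgets the coefficients over `H`. -/
noncomputable def projRel (H : Γ.Subgraph) (x : Γ.Chain₁ a) : Γ.Chain₁ a :=
  x.filter fun e => e ∈ outside a H

/-! ### Nielsen 1-chains -/

/-- `ρ` is the relative part of the 1-chain `[u, v]` (the 1-chain `c` with `∂ c = v - u`, unique
as the universal cover is a tree) for vertices `u`, `v` that are fixed by the lift of `f`. -/
def IsFixedSegment (f : Γ.SelfMap) (ha : f.onV a = a) (H : Γ.Subgraph) (ρ : Γ.Chain₁ a) : Prop :=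
  ∃ (u v : Γ.CoverVertex a) (c : Γ.Chain₁ a),
    f.lift ha u = u ∧ f.lift ha v = v ∧
    boundary c = Finsupp.single v 1 - Finsupp.single u 1 ∧ ρ = projRel H c

/-- The condition on a non-geometric Nielsen 1-chain. -/
def IsNonGeometric (H : Γ.Subgraph) (ρ : Γ.Chain₁ a) : Prop :=
  ∃ e ∈ outside a H, (ρ e = 1 ∨ ρ e = -1) ∧ ∀ g : Γ.π₁ a, g ≠ 1 → ρ (g • e) = 0

/-- The three conditions on a geometric Nielsen 1-chain. -/
structure IsGeometric (H : Γ.Subgraph) (ρ : Γ.Chain₁ a) : Prop where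
  single : ∀ g₁ g₂ : Γ.π₁ a, g₁ ≠ g₂ →
    supp (translate g₁ ρ) ∩ supp (translate g₂ ρ) = ∅ ∨
      ∃ e, supp (translate g₁ ρ) ∩ supp (translate g₂ ρ) = {e}
  pair : ∀ e ∈ outside a H, ∃ g₁ g₂ : Γ.π₁ a, g₁ ≠ g₂ ∧
    supp (translate g₁ ρ) ∩ supp (translate g₂ ρ) = {e} ∧
    ∀ h₁ h₂ : Γ.π₁ a, h₁ ≠ h₂ → supp (translate h₁ ρ) ∩ supp (translate h₂ ρ) = {e} →
      (h₁ = g₁ ∧ h₂ = g₂) ∨ (h₁ = g₂ ∧ h₂ = g₁)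
  noncommuting : ∃ g₁ g₂ : Γ.π₁ a, g₁ * g₂ ≠ g₂ * g₁ ∧
    (supp ρ ∩ supp (translate g₁ ρ)).Nonempty ∧ (supp ρ ∩ supp (translate g₂ ρ)).Nonempty

/-- Nielsen 1-chains. -/
def IsNielsen (f : Γ.SelfMap) (ha : f.onV a = a) (H : Γ.Subgraph) (ρ : Γ.Chain₁ a) : Prop :=
  IsFixedSegment f ha H ρ ∧ (IsNonGeometric H ρ ∨ IsGeometric H ρ)

/-- `ρ` generates `U` as a module over the rational group algebra of the fundamental group:
`ρ ∈ U` and every element of `U` is of the form `q₁ g₁ ρ + ⋯ + q_r g_r ρ`. -/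
def Generates (ρ : Γ.Chain₁ a) (U : Submodule ℚ (Γ.Chain₁ a)) : Prop :=
  ρ ∈ U ∧ ∀ x ∈ U, ∃ q : Γ.π₁ a →₀ ℚ, x = q.sum fun g c => c • translate g ρ

/-- `U` is a quasi-fixed submodule: a submodule of the relative 1-chains over the rational group
algebra of the fundamental group which is zero or generated by a Nielsen 1-chain. -/
structure IsQuasiFixed (f : Γ.SelfMap) (ha : f.onV a = a) (H : Γ.Subgraph)
    (U : Submodule ℚ (Γ.Chain₁ a)) : Prop where
  le_rel : U ≤ relChains a H
  translate_mem : ∀ (g : Γ.π₁ a), ∀ x ∈ U, translate g x ∈ U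
  generated : U ≠ ⊥ → ∃ ρ, IsNielsen f ha H ρ ∧ Generates ρ U

end CellGraph

/-! ### The Hilbert modules `L²(G)ⁿ` -/

/-- `L²(G)`: square summable functions `G → ℂ`. -/
abbrev L2 (G : Type*) : Type _ := lp (fun _ : G => ℂ) 2

/-- The Hilbert space `L²(G)ⁿ`. -/
abbrev L2n (G : Type*) (n : ℕ) : Type _ := PiLp 2 fun _ : Fin n => L2 G

namespace L2

theorem summable_sq {G : Type*} (ξ : L2 G) : Summable fun x => ‖ξ x‖ ^ (2 : ENNReal).toReal :=
  (memℓp_gen_iff (by norm_num)).1 ξ.2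

/-- The left action of `G` on `L²(G)`: `(h ξ)_g = ξ_{h⁻¹ g}`. -/
def act {G : Type*} [Group G] (h : G) : L2 G →ₗ[ℂ] L2 G where
  toFun ξ := ⟨fun g => ξ (h⁻¹ * g), (memℓp_gen_iff (by norm_num)).2
    ((summable_sq ξ).comp_injective (mul_right_injective h⁻¹))⟩
  map_add' _ _ := rfl
  map_smul' _ _ := rfl

/-- Extension by zero `L²(F) → L²(G)` along an injective homomorphism `F → G`. -/
noncomputable def ext {F G : Type*} [Group F] [Group G] (ι : F →* G)
    (hι : Function.Injective ι) : L2 F →ₗ[ℂ] L2 G where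
  toFun ξ := ⟨Function.extend ι (fun g => ξ g) 0, (memℓp_gen_iff (by norm_num)).2 (by
    refine (hι.summable_iff fun x hx => ?_).1 ?_
    · rw [Function.extend_apply' _ _ _ (by simpa using hx)]
      simp
    · simpa [Function.comp_def, hι.extend_apply] using summable_sq ξ)⟩
  map_add' ξ η := by
    refine Subtype.ext (funext fun x => ?_)
    change Function.extend ι (fun g => ξ g + η g) 0 x =
      Function.extend ι (fun g => ξ g) 0 x + Function.extend ι (fun g => η g) 0 x
    by_cases hx : ∃ g, ι g = x
    · obtain ⟨g, rfl⟩ := hx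
      simp [hι.extend_apply]
    · simp [Function.extend_apply' _ _ _ hx]
  map_smul' c ξ := by
    refine Subtype.ext (funext fun x => ?_)
    change Function.extend ι (fun g => c * ξ g) 0 x = c * Function.extend ι (fun g => ξ g) 0 x
    by_cases hx : ∃ g, ι g = x
    · obtain ⟨g, rfl⟩ := hx
      simp [hι.extend_apply]
    · simp [Function.extend_apply' _ _ _ hx]

end L2

namespace L2n

/-- A linear map applied to each coordinate. -/
noncomputable def mapCoord {F G : Type*} {n : ℕ} (T : L2 F →ₗ[ℂ] L2 G) : L2n F n →ₗ[ℂ] L2n G n where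
  toFun ξ := WithLp.toLp 2 fun i => T (ξ i)
  map_add' ξ η := by ext i : 1; simp
  map_smul' c ξ := by ext i : 1; simp

/-- The left action of `G` on `L²(G)ⁿ`. -/
noncomputable def act {G : Type*} [Group G] {n : ℕ} (h : G) : L2n G n →ₗ[ℂ] L2n G n := mapCoord (L2.act h)

end L2n

/-! ### The free-by-cyclic group -/

/-- The semidirect product `F ⋊_Φ ⟨t⟩` with `t⁻¹ x t = Φ x` for `x ∈ F`. (In Mathlib's semidirect
product the cyclic factor acts by `t x t⁻¹`, which is `Φ⁻¹ x`.) -/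
abbrev FreeByCyclic {F : Type*} [Group F] (Φ : MulAut F) : Type _ :=
  F ⋊[zpowersHom (MulAut F) Φ⁻¹] Multiplicative ℤ

/-- The stable letter `t`. -/
def FreeByCyclic.t {F : Type*} [Group F] (Φ : MulAut F) : FreeByCyclic Φ :=
  SemidirectProduct.inr (Multiplicative.ofAdd 1)

theorem FreeByCyclic.t_inv_mul_mul_t {F : Type*} [Group F] (Φ : MulAut F) (x : F) :
    (FreeByCyclic.t Φ)⁻¹ * SemidirectProduct.inl x * FreeByCyclic.t Φ =
      SemidirectProduct.inl (Φ x) := by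
  have h := SemidirectProduct.inl_aut (φ := zpowersHom (MulAut F) Φ⁻¹)
    (Multiplicative.ofAdd (-1 : ℤ)) x
  simp only [zpowersHom_apply, toAdd_ofAdd, zpow_neg, zpow_one, inv_inv] at h
  rw [h, FreeByCyclic.t]
  simp [ofAdd_neg]

/-! ### The modules `V_qf^{(2)}` and `W_qf^{(2)}` -/

namespace CellGraph

variable {V E : Type*} {Γ : CellGraph V E}

/-- A basis of the relative 1-chains over the group algebra that consists of `n` edges of the
universal cover, one above each edge of `Γ` outside `H`. -/
structure EdgeBasis (Γ : CellGraph V E) (a : V) (H : Γ.Subgraph) (n : ℕ) where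
  edge : Fin n → Γ.CoverEdge a
  bijOn : Set.BijOn (fun i => (edge i).proj) Set.univ H.edgesᶜ

variable {a : V} {H : Γ.Subgraph} {n : ℕ}

/-- The coordinates in `L²(F)ⁿ` of a 1-chain with respect to a basis of edges `b₁, …, bₙ`: the
`i`-th coordinate of `x` is `∑ g, x_{g b_i} g`. -/
noncomputable def EdgeBasis.coord (b : EdgeBasis Γ a H n) (x : Γ.Chain₁ a) :
    L2n (Γ.π₁ a) n :=
  WithLp.toLp 2 fun i => ⟨fun g => ((x (g • b.edge i) : ℚ) : ℂ),
    (memℓp_gen_iff (by norm_num)).2 (summable_of_hasFiniteSupport (by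
      refine ((x.support.finite_toSet.preimage
        (CoverEdge.smul_left_injective (b.edge i)).injOn)).subset fun g hg => ?_
      simp only [Set.mem_preimage, Finset.mem_coe, Finsupp.mem_support_iff]
      intro h0
      exact hg (by simp [h0])))⟩

/-- The Hilbert module `U^{(2)}` of a submodule `U` of relative 1-chains: the closure in `L²(F)ⁿ`
of the complex span of `U`. -/
noncomputable def hilbert (b : EdgeBasis Γ a H n) (U : Submodule ℚ (Γ.Chain₁ a)) :
    Submodule ℂ (L2n (Γ.π₁ a) n) :=
  (Submodule.span ℂ (b.coord '' U)).topologicalClosure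

end CellGraph

/-- For a subspace `U` of `L²(F)ⁿ`, the induced subspace `ι_* U`: the closure in `L²(F ⋊_Φ ⟨t⟩)ⁿ`
of the sum over `ℓ ∈ ℤ` of the (mutually orthogonal) subspaces `t^ℓ U`. -/
noncomputable def inducedModule {F : Type*} [Group F] (Φ : MulAut F) {n : ℕ}
    (U : Submodule ℂ (L2n F n)) : Submodule ℂ (L2n (FreeByCyclic Φ) n) :=
  (⨆ ℓ : ℤ, (U.map (L2n.mapCoord
      (L2.ext (SemidirectProduct.inl : F →* FreeByCyclic Φ)
        SemidirectProduct.inl_injective))).map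
    (L2n.act (FreeByCyclic.t Φ ^ ℓ))).topologicalClosure


/-!
In the coordinates given by the chosen edges, `q ↦ q ρ` is right convolution `T` with the
coordinates of `ρ`, and the two modules are the closures of the ranges of `T` on `L²(F)` and on
`L²(G)`. It is enough to bound `T` below, on `L²(G)` for any group `G` that contains `F`. If `ρ` is
non-geometric, some coordinate of `T` is a nonzero multiple of a right translation. If `ρ` is
geometric and `s ≠ 1` is such that `ρ` and `s ρ` overlap, some coordinate of `T` is, up to a right
translation, `ξ ↦ α ξ + β R_s ξ` with `(R_s ξ)_x = ξ_{x s}` and `α ≠ 0`; hence if `T ξ` is small,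
then `A ↦ ‖1_A ξ‖` is almost invariant under right translation of `A` by `s`. This holds for two
non-commuting `s`, which generate a free group of rank two; as that group is paradoxical, `ξ` itself
is small.
-/

open scoped NNReal

/-! ### Almost invariant set functions and paradoxical sets -/

section Paradoxical

variable {G : Type*} [Group G]

/-- `v` changes by at most `δ` when its argument is translated by `g` on the right. It is used for
the set functions `A ↦ ‖1_A ξ‖` with `ξ ∈ L²(G)`. -/
def IsAlmostInvariant (v : Set G → ℝ) (δ : ℝ) (g : G) : Prop :=
  ∀ A : Set G, |v ((· * g) ⁻¹' A) - v A| ≤ δ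

namespace IsAlmostInvariant

variable {v : Set G → ℝ} {δ ε : ℝ} {g h : G}

theorem one (v : Set G → ℝ) : IsAlmostInvariant v 0 1 := fun A => by simp

theorem mul (hg : IsAlmostInvariant v δ g) (hh : IsAlmostInvariant v ε h) :
    IsAlmostInvariant v (δ + ε) (g * h) := fun A => by
  have hgh : (· * (g * h)) ⁻¹' A = (· * g) ⁻¹' ((· * h) ⁻¹' A) := by
    ext x
    simp only [Set.mem_preimage, mul_assoc]
  rw [hgh]
  exact (abs_sub_le _ _ _).trans (add_le_add (hg _) (hh A))

theorem inv (hg : IsAlmostInvariant v δ g) : IsAlmostInvariant v δ g⁻¹ := fun A => by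
  have hA : (· * g) ⁻¹' ((· * g⁻¹) ⁻¹' A) = A := by
    ext x
    simp only [Set.mem_preimage, mul_inv_cancel_right]
  have := hg ((· * g⁻¹) ⁻¹' A)
  rwa [hA, abs_sub_comm] at this

theorem mono (hg : IsAlmostInvariant v δ g) (h : δ ≤ ε) : IsAlmostInvariant v ε g :=
  fun A => (hg A).trans h

theorem nonneg (hg : IsAlmostInvariant v δ g) : 0 ≤ δ :=
  (abs_nonneg _).trans (hg ∅)

theorem exists_of_mem_closure {S : Set G} (hg : g ∈ Subgroup.closure S) :
    ∃ C : ℝ≥0, ∀ (v : Set G → ℝ) (δ : ℝ), (∀ s ∈ S, IsAlmostInvariant v δ s) →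
      IsAlmostInvariant v (C * δ) g := by
  induction hg using Subgroup.closure_induction with
  | mem s hs => exact ⟨1, fun v δ h => by simpa using h s hs⟩
  | one => exact ⟨0, fun v δ _ => by simpa using one v⟩
  | mul x y _ _ hx hy =>
    obtain ⟨⟨C, hC⟩, D, hD⟩ := hx, hy
    exact ⟨C + D, fun v δ h => by simpa [add_mul] using (hC v δ h).mul (hD v δ h)⟩
  | inv x _ hx =>
    obtain ⟨C, hC⟩ := hx
    exact ⟨C, fun v δ h => (hC v δ h).inv⟩

end IsAlmostInvariant

/-- `A` witnesses that right translation on `G` is paradoxical: two translates of `A` cover `G`,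
but three translates of `A` are pairwise disjoint. -/
structure IsParadoxical (p q r : G) (A : Set G) : Prop where
  union_eq : A ∪ (· * p) ⁻¹' A = Set.univ
  disjoint_left : Disjoint A ((· * q) ⁻¹' A)
  disjoint_right : Disjoint (A ∪ (· * q) ⁻¹' A) ((· * r) ⁻¹' A)

theorem exists_rightEquivariant_retraction {M : Type*} [Group M] {j : M →* G}
    (hj : Function.Injective j) : ∃ m : G → M, ∀ g k, m (g * j k) = m g * k := by
  obtain ⟨S, hS, -⟩ := j.range.exists_isComplement_left 1
  refine ⟨fun g => (MonoidHom.ofInjective hj).symm (hS.equiv g).2, fun g k => ?_⟩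
  have hk := hS.equiv_mul_right g (MonoidHom.ofInjective hj k)
  rw [MonoidHom.ofInjective_apply] at hk
  simp only [hk, map_mul, MulEquiv.symm_apply_apply]

theorem IsParadoxical.exists_map {M : Type*} [Group M] {p q r : M} {A : Set M}
    (hA : IsParadoxical p q r A) {j : M →* G} (hj : Function.Injective j) :
    ∃ B : Set G, IsParadoxical (j p) (j q) (j r) B := by
  obtain ⟨m, hm⟩ := exists_rightEquivariant_retraction hj
  have hpre (k : M) : (· * j k) ⁻¹' (m ⁻¹' A) = m ⁻¹' ((· * k) ⁻¹' A) := by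
    ext x
    simp only [Set.mem_preimage, hm]
  refine ⟨m ⁻¹' A, ?_, ?_, ?_⟩
  · rw [hpre, ← Set.preimage_union, hA.union_eq, Set.preimage_univ]
  · rw [hpre]
    exact hA.disjoint_left.preimage m
  · rw [hpre, hpre, ← Set.preimage_union]
    exact hA.disjoint_right.preimage m

theorem exists_isParadoxical_freeGroup {X : Type*} {x y : X} (hxy : x ≠ y) :
    ∃ A : Set (FreeGroup X),
      IsParadoxical (FreeGroup.of x) (FreeGroup.of y)⁻¹ ((FreeGroup.of y) ^ 2)⁻¹ A := by
  classical
  let B := FreeGroup.startsWith (x, true) ∪ FreeGroup.startsWith (x, false)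
  let S := FreeGroup.startsWith (y, true)
  have hB (b : Bool) : Disjoint B (FreeGroup.startsWith (y, b)) := by
    rw [Set.disjoint_union_left, FreeGroup.startsWith.disjoint_iff_ne,
      FreeGroup.startsWith.disjoint_iff_ne]
    exact ⟨fun h => hxy (congrArg Prod.fst h), fun h => hxy (congrArg Prod.fst h)⟩
  have hcover (z : FreeGroup X) : z ∈ B ∨ (FreeGroup.of x)⁻¹ * z ∈ B := by
    by_cases hz : z ∈ FreeGroup.startsWith (x, true)
    · exact Or.inl (Or.inl hz)
    · exact Or.inr (Or.inr (FreeGroup.startsWith_mk_mul (w := (x, false)) z hz))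
  have hBS {z : FreeGroup X} (hz : z ∈ B) : FreeGroup.of y * z ∈ S :=
    FreeGroup.startsWith_mk_mul (w := (y, true)) z (Set.disjoint_left.1 (hB false) hz)
  have hSS {z : FreeGroup X} (hz : z ∈ S) : FreeGroup.of y * z ∈ S :=
    FreeGroup.startsWith_mk_mul (w := (y, true)) z
      (Set.disjoint_left.1 (FreeGroup.startsWith.disjoint_iff_ne.2 (by simp)) hz)
  refine ⟨Inv.inv ⁻¹' B, ?_, ?_, ?_⟩
  · refine Set.eq_univ_of_forall fun g => ?_
    simpa only [Set.mem_union, Set.mem_preimage, mul_inv_rev] using hcover g⁻¹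
  · refine Set.disjoint_left.2 fun g hg hyg => Set.disjoint_left.1 (hB true) hyg ?_
    simpa only [mul_inv_rev, inv_inv] using hBS hg
  · refine Set.disjoint_left.2 fun g hg hyyg => Set.disjoint_left.1 (hB true) hyyg ?_
    rw [mul_inv_rev, inv_inv, sq, mul_assoc]
    rcases hg with hg | hyg
    · exact hSS (hBS hg)
    · simpa only [mul_inv_rev, inv_inv] using hBS hyg

theorem exists_generators_ne_of_not_commute {M : Type*} [Group M] [IsFreeGroup M] {g h : M}
    (hgh : ¬ Commute g h) : ∃ x y : IsFreeGroup.Generators M, x ≠ y := by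
  by_contra! hsub
  have : Subsingleton (IsFreeGroup.Generators M) := ⟨hsub⟩
  refine hgh ((IsFreeGroup.toFreeGroup M).injective ?_)
  rw [map_mul, map_mul]
  rcases isEmpty_or_nonempty (IsFreeGroup.Generators M) with _ | ⟨⟨c⟩⟩
  · exact Subsingleton.elim _ _
  · have : Unique (IsFreeGroup.Generators M) := ⟨⟨c⟩, fun _ => Subsingleton.elim _ _⟩
    exact mul_comm' _ _

theorem exists_isParadoxical_of_not_commute {F : Type*} [Group F] [IsFreeGroup F] {j : F →* G}
    (hj : Function.Injective j) {s t : F} (hst : ¬ Commute s t) :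
    ∃ p ∈ Subgroup.closure {s, t}, ∃ q ∈ Subgroup.closure {s, t},
      ∃ r ∈ Subgroup.closure {s, t}, ∃ A : Set G, IsParadoxical (j p) (j q) (j r) A := by
  let N := Subgroup.closure {s, t}
  have hN : ¬ Commute (⟨s, Subgroup.subset_closure (by simp)⟩ : N)
      ⟨t, Subgroup.subset_closure (by simp)⟩ := fun h => hst (congrArg Subtype.val h)
  obtain ⟨x, y, hxy⟩ := exists_generators_ne_of_not_commute hN
  obtain ⟨A₀, hA₀⟩ := exists_isParadoxical_freeGroup hxy
  let e : FreeGroup (IsFreeGroup.Generators N) ≃* N := (IsFreeGroup.toFreeGroup N).symm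
  let i : FreeGroup (IsFreeGroup.Generators N) →* G := (j.comp N.subtype).comp e.toMonoidHom
  have hi : Function.Injective i := (hj.comp N.subtype_injective).comp e.injective
  exact ⟨_, (e _).2, _, (e _).2, _, (e _).2, hA₀.exists_map hi⟩

end Paradoxical

/-! ### Spectral gap of right translation on `L²(G)` -/

namespace L2

theorem norm_sq_eq_tsum {X : Type*} (ξ : L2 X) : ‖ξ‖ ^ 2 = ∑' x, ‖ξ x‖ ^ 2 := by
  simpa using lp.norm_rpow_eq_tsum (p := 2) (by norm_num) ξ

/-- The restriction `1_A ξ` of a square summable function to a set, extended by zero. -/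
noncomputable def restrict {X : Type*} (A : Set X) : L2 X →ₗ[ℂ] L2 X where
  toFun ξ := ⟨A.indicator ξ, (lp.memℓp ξ).mono' fun x => norm_indicator_le_norm_self _ x⟩
  map_add' ξ η := lp.ext (Set.indicator_add A ξ η)
  map_smul' c ξ := lp.ext (Set.indicator_const_smul A c ξ)

section Restrict

variable {X : Type*} {A B : Set X}

theorem coe_restrict (A : Set X) (ξ : L2 X) : ⇑(restrict A ξ) = A.indicator ξ := rfl

theorem restrict_univ (ξ : L2 X) : restrict Set.univ ξ = ξ :=
  lp.ext (Set.indicator_univ ξ)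

theorem norm_restrict_le (A : Set X) (ξ : L2 X) : ‖restrict A ξ‖ ≤ ‖ξ‖ :=
  lp.norm_mono two_ne_zero fun x => norm_indicator_le_norm_self _ x

theorem norm_restrict_mono (hAB : A ⊆ B) (ξ : L2 X) : ‖restrict A ξ‖ ≤ ‖restrict B ξ‖ :=
  lp.norm_mono two_ne_zero fun x => norm_indicator_le_of_subset hAB _ x

theorem norm_restrict_sq_eq_tsum (A : Set X) (ξ : L2 X) :
    ‖restrict A ξ‖ ^ 2 = ∑' x, A.indicator (fun x => ‖ξ x‖ ^ 2) x := by
  rw [norm_sq_eq_tsum]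
  refine tsum_congr fun x => ?_
  by_cases hx : x ∈ A <;> simp [coe_restrict, hx]

theorem norm_restrict_union_sq (hAB : Disjoint A B) (ξ : L2 X) :
    ‖restrict (A ∪ B) ξ‖ ^ 2 = ‖restrict A ξ‖ ^ 2 + ‖restrict B ξ‖ ^ 2 := by
  have hξ : Summable fun x => ‖ξ x‖ ^ 2 := by simpa using summable_sq ξ
  simp only [norm_restrict_sq_eq_tsum, Set.indicator_union_of_disjoint hAB]
  exact (hξ.indicator A).tsum_add (hξ.indicator B)

theorem norm_restrict_union_sq_le (A B : Set X) (ξ : L2 X) :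
    ‖restrict (A ∪ B) ξ‖ ^ 2 ≤ ‖restrict A ξ‖ ^ 2 + ‖restrict B ξ‖ ^ 2 := by
  rw [← Set.union_sdiff_self, norm_restrict_union_sq Set.disjoint_sdiff_right]
  gcongr
  exact norm_restrict_mono Set.sdiff_subset ξ

end Restrict

variable {G : Type*} [Group G]

theorem norm_le_of_isParadoxical {p q r : G} {A : Set G} (hA : IsParadoxical p q r A) {ξ : L2 G}
    {δ : ℝ} (hp : IsAlmostInvariant (fun B => ‖restrict B ξ‖) δ p)
    (hq : IsAlmostInvariant (fun B => ‖restrict B ξ‖) δ q)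
    (hr : IsAlmostInvariant (fun B => ‖restrict B ξ‖) δ r) : ‖ξ‖ ≤ 10 * δ := by
  have hδ : 0 ≤ δ := hp.nonneg
  have hcover : ‖ξ‖ ^ 2 ≤ ‖restrict A ξ‖ ^ 2 + ‖restrict ((· * p) ⁻¹' A) ξ‖ ^ 2 := by
    have := norm_restrict_union_sq_le A ((· * p) ⁻¹' A) ξ
    rwa [hA.union_eq, restrict_univ] at this
  have hpack : ‖restrict A ξ‖ ^ 2 + ‖restrict ((· * q) ⁻¹' A) ξ‖ ^ 2 +
      ‖restrict ((· * r) ⁻¹' A) ξ‖ ^ 2 ≤ ‖ξ‖ ^ 2 := by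
    rw [← norm_restrict_union_sq hA.disjoint_left, ← norm_restrict_union_sq hA.disjoint_right]
    gcongr
    exact norm_restrict_le _ ξ
  have hpA := abs_le.1 (hp A)
  have hqA := abs_le.1 (hq A)
  have hrA := abs_le.1 (hr A)
  have hsmall : ‖restrict A ξ‖ ≤ 6 * δ := by
    by_contra! hlarge
    nlinarith [norm_nonneg (restrict ((· * p) ⁻¹' A) ξ)]
  refine abs_le_of_sq_le_sq' ?_ (by positivity) |>.2
  nlinarith [norm_nonneg (restrict A ξ), norm_nonneg (restrict ((· * p) ⁻¹' A) ξ)]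

theorem exists_norm_le_of_isAlmostInvariant {F : Type*} [Group F] [IsFreeGroup F] {j : F →* G}
    (hj : Function.Injective j) {s t : F} (hst : ¬ Commute s t) :
    ∃ C : ℝ≥0, ∀ (ξ : L2 G) (δ : ℝ), IsAlmostInvariant (fun A => ‖restrict A ξ‖) δ (j s) →
      IsAlmostInvariant (fun A => ‖restrict A ξ‖) δ (j t) → ‖ξ‖ ≤ C * δ := by
  obtain ⟨p, hp, q, hq, r, hr, A, hA⟩ := exists_isParadoxical_of_not_commute hj hst
  have hclosure {k : F} (hk : k ∈ Subgroup.closure {s, t}) :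
      j k ∈ Subgroup.closure {j s, j t} := by
    rw [← Set.image_pair, ← MonoidHom.map_closure]
    exact Subgroup.mem_map_of_mem j hk
  obtain ⟨P, hP⟩ := IsAlmostInvariant.exists_of_mem_closure (hclosure hp)
  obtain ⟨Q, hQ⟩ := IsAlmostInvariant.exists_of_mem_closure (hclosure hq)
  obtain ⟨R, hR⟩ := IsAlmostInvariant.exists_of_mem_closure (hclosure hr)
  refine ⟨10 * (P ⊔ Q ⊔ R), fun ξ δ hs ht => ?_⟩
  have hδ : 0 ≤ δ := hs.nonneg
  have hst : ∀ g ∈ ({j s, j t} : Set G), IsAlmostInvariant (fun A => ‖restrict A ξ‖) δ g := by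
    rintro g (rfl | rfl) <;> assumption
  have hgap := norm_le_of_isParadoxical hA (δ := (P ⊔ Q ⊔ R : ℝ≥0) * δ)
    ((hP _ _ hst).mono (by gcongr; simp)) ((hQ _ _ hst).mono (by gcongr; simp))
    ((hR _ _ hst).mono (by gcongr; simp))
  rwa [← mul_assoc] at hgap

end L2

/-! ### Right convolution -/

namespace L2

theorem topologicalClosure_range_eq_span_single {G X : Type*} [DecidableEq G]
    [NormedAddCommGroup X] [NormedSpace ℂ X] (T : L2 G →L[ℂ] X) :
    T.range.topologicalClosure =
      (Submodule.span ℂ (Set.range fun g => T (lp.single 2 g 1))).topologicalClosure := by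
  refine le_antisymm (Submodule.topologicalClosure_minimal _ ?_
    (Submodule.isClosed_topologicalClosure _)) (Submodule.topologicalClosure_mono ?_)
  · rintro _ ⟨ξ, rfl⟩
    refine mem_closure_of_tendsto ((lp.hasSum_single (by norm_num) ξ).mapL T)
      (Filter.Eventually.of_forall fun s => sum_mem fun g _ => ?_)
    have hg : lp.single 2 g (ξ g) = ξ g • (lp.single 2 g (1 : ℂ) : L2 G) := by
      rw [← lp.single_smul, smul_eq_mul, mul_one]
    rw [hg, map_smul]
    exact Submodule.smul_mem _ _ (Submodule.subset_span ⟨g, rfl⟩)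
  · exact Submodule.span_le.2 (Set.range_subset_iff.2 fun g => ⟨_, rfl⟩)

variable {G : Type*} [Group G]

/-- Right translation `(R_g ξ)_x = ξ_{x g}`. -/
def rightTranslate (g : G) : L2 G →ₗᵢ[ℂ] L2 G where
  toFun ξ := ⟨fun x => ξ (x * g), (memℓp_gen_iff (by norm_num)).2
    ((summable_sq ξ).comp_injective (mul_left_injective g))⟩
  map_add' _ _ := rfl
  map_smul' _ _ := rfl
  norm_map' ξ := by
    rw [← sq_eq_sq₀ (norm_nonneg _) (norm_nonneg _), norm_sq_eq_tsum, norm_sq_eq_tsum]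
    exact (Equiv.mulRight g).tsum_eq fun x => ‖ξ x‖ ^ 2

theorem rightTranslate_apply (g : G) (ξ : L2 G) (x : G) : rightTranslate g ξ x = ξ (x * g) := rfl

theorem rightTranslate_mul (g h : G) (ξ : L2 G) :
    rightTranslate (g * h) ξ = rightTranslate g (rightTranslate h ξ) := by
  ext x
  simp only [rightTranslate_apply, mul_assoc]

theorem restrict_preimage_rightTranslate (A : Set G) (g : G) (ξ : L2 G) :
    restrict ((· * g) ⁻¹' A) (rightTranslate g ξ) = rightTranslate g (restrict A ξ) := rfl

/-- Comparing norms on all of `G` bounds `(|α| - |β|) ‖ξ‖`, so that `β` may be replaced by `α` on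
each `A`. -/
theorem isAlmostInvariant_norm_restrict {α : ℂ} (hα : α ≠ 0) (β : ℂ) (g : G) (ξ : L2 G) :
    IsAlmostInvariant (fun A => ‖restrict A ξ‖)
      (2 * ‖α‖⁻¹ * ‖α • ξ + β • rightTranslate g ξ‖) g := by
  intro A
  set η := α • ξ + β • rightTranslate g ξ
  set B := (· * g) ⁻¹' A with hB
  have hdiff (x y : L2 G) (hx : ‖α • x + β • y‖ ≤ ‖η‖) : |‖α‖ * ‖x‖ - ‖β‖ * ‖y‖| ≤ ‖η‖ := by
    have h := abs_norm_sub_norm_le (α • x) (-(β • y))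
    rw [norm_neg, sub_neg_eq_add, norm_smul, norm_smul] at h
    exact h.trans hx
  have hloc : |‖α‖ * ‖restrict B ξ‖ - ‖β‖ * ‖restrict A ξ‖| ≤ ‖η‖ := by
    have hBη : ‖α • restrict B ξ + β • restrict B (rightTranslate g ξ)‖ ≤ ‖η‖ := by
      rw [← map_smul, ← map_smul, ← map_add]
      exact norm_restrict_le B η
    have := hdiff _ _ hBη
    rwa [hB, restrict_preimage_rightTranslate, LinearIsometry.norm_map, ← hB] at this
  have hglob : |‖α‖ * ‖ξ‖ - ‖β‖ * ‖ξ‖| ≤ ‖η‖ := by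
    simpa using hdiff ξ (rightTranslate g ξ) le_rfl
  have hA : |‖α‖ * ‖restrict A ξ‖ - ‖β‖ * ‖restrict A ξ‖| ≤ ‖η‖ := by
    refine le_trans ?_ hglob
    rw [← sub_mul, ← sub_mul, abs_mul, abs_mul, abs_norm, abs_norm]
    gcongr
    exact norm_restrict_le A ξ
  have hα' : ‖α‖ ≠ 0 := norm_ne_zero_iff.2 hα
  calc |‖restrict B ξ‖ - ‖restrict A ξ‖|
      = ‖α‖⁻¹ * |‖α‖ * ‖restrict B ξ‖ - ‖β‖ * ‖restrict A ξ‖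
          - (‖α‖ * ‖restrict A ξ‖ - ‖β‖ * ‖restrict A ξ‖)| := by
        rw [sub_sub_sub_cancel_right, ← mul_sub, abs_mul, abs_norm, inv_mul_cancel_left₀ hα']
    _ ≤ ‖α‖⁻¹ * (‖η‖ + ‖η‖) := by
        gcongr
        exact (abs_sub _ _).trans (add_le_add hloc hA)
    _ = 2 * ‖α‖⁻¹ * ‖η‖ := by ring

theorem act_apply (g : G) (ξ : L2 G) (x : G) : act g ξ x = ξ (g⁻¹ * x) := rfl

theorem act_single [DecidableEq G] (g h : G) (c : ℂ) :
    act g (lp.single 2 h c) = lp.single 2 (g * h) c := by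
  ext x
  simp only [act_apply, lp.single_apply, Pi.single_apply, inv_mul_eq_iff_eq_mul]

section Ext

variable {F : Type*} [Group F] {ι : F →* G} (hι : Function.Injective ι)

theorem ext_apply (ξ : L2 F) (x : F) : ext ι hι ξ (ι x) = ξ x :=
  hι.extend_apply _ _ _

theorem ext_apply_of_notMem_range (ξ : L2 F) {x : G} (hx : x ∉ ι.range) : ext ι hι ξ x = 0 :=
  Function.extend_apply' _ _ _ hx

theorem ext_single [DecidableEq F] [DecidableEq G] (g : F) (c : ℂ) :
    ext ι hι (lp.single 2 g c) = lp.single 2 (ι g) c := by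
  ext x
  by_cases hx : x ∈ ι.range
  · obtain ⟨y, rfl⟩ := hx
    simp only [ext_apply, lp.single_apply, Pi.single_apply, hι.eq_iff]
  · rw [ext_apply_of_notMem_range hι _ hx, lp.single_apply, Pi.single_apply, if_neg]
    rintro rfl
    exact hx ⟨g, rfl⟩

end Ext

end L2

namespace L2n

variable {F G : Type*} [Group F] [Group G] {n : ℕ}

theorem act_apply (g : G) (η : L2n G n) (i : Fin n) (x : G) : act g η i x = η i (g⁻¹ * x) := rfl

/-- Right convolution `L²(G) → L²(G)ⁿ` with an `n`-tuple of finitely supported functions on `F`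
that are pushed forward to `G` along `ι`. -/
noncomputable def convolve (ι : F →* G) (r : Fin n → F →₀ ℂ) : L2 G →L[ℂ] L2n G n :=
  (PiLp.continuousLinearEquiv 2 ℂ fun _ : Fin n => L2 G).symm.toContinuousLinearMap ∘L
    ContinuousLinearMap.pi fun i =>
      (r i).sum fun k c => c • (L2.rightTranslate (ι k)⁻¹).toContinuousLinearMap

theorem convolve_coord (ι : F →* G) (r : Fin n → F →₀ ℂ) (ξ : L2 G) (i : Fin n) :
    convolve ι r ξ i = (r i).sum fun k c => c • L2.rightTranslate (ι k)⁻¹ ξ := by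
  change ((r i).sum fun k c => c • (L2.rightTranslate (ι k)⁻¹).toContinuousLinearMap) ξ = _
  rw [Finsupp.sum, Finsupp.sum, sum_apply]
  rfl

theorem convolve_apply (ι : F →* G) (r : Fin n → F →₀ ℂ) (ξ : L2 G) (i : Fin n) (x : G) :
    convolve ι r ξ i x = (r i).sum fun k c => c * ξ (x * (ι k)⁻¹) := by
  rw [convolve_coord, Finsupp.sum, Finsupp.sum, lp.coeFn_sum, Finset.sum_apply]
  rfl

theorem convolve_act (ι : F →* G) (r : Fin n → F →₀ ℂ) (g : G) (ξ : L2 G) :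
    convolve ι r (L2.act g ξ) = act g (convolve ι r ξ) := by
  ext i x
  simp only [act_apply, convolve_apply, L2.act_apply, mul_assoc]

theorem convolve_ext {ι : F →* G} (hι : Function.Injective ι) (r : Fin n → F →₀ ℂ) (ξ : L2 F) :
    convolve ι r (L2.ext ι hι ξ) =
      mapCoord (L2.ext ι hι) (convolve (MonoidHom.id F) r ξ) := by
  ext i x
  change _ = L2.ext ι hι (convolve (MonoidHom.id F) r ξ i) x
  rw [convolve_apply]
  by_cases hx : x ∈ ι.range
  · obtain ⟨y, rfl⟩ := hx
    rw [L2.ext_apply, convolve_apply]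
    simp only [← map_inv, ← map_mul, L2.ext_apply, MonoidHom.id_apply]
  · rw [L2.ext_apply_of_notMem_range hι _ hx]
    refine Finset.sum_eq_zero fun k _ => ?_
    refine mul_eq_zero_of_right _ (L2.ext_apply_of_notMem_range hι _ ?_)
    rwa [Subgroup.mul_mem_cancel_right _ (inv_mem (MonoidHom.mem_range.2 ⟨k, rfl⟩))]

theorem norm_mul_le_norm_convolve (ι : F →* G) {r : Fin n → F →₀ ℂ} {i : Fin n} {k : F}
    (hr : (r i).support = {k}) (ξ : L2 G) : ‖r i k‖ * ‖ξ‖ ≤ ‖convolve ι r ξ‖ := by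
  refine le_trans (le_of_eq ?_) (PiLp.norm_apply_le (convolve ι r ξ) i)
  rw [convolve_coord, Finsupp.sum, hr, Finset.sum_singleton, norm_smul, LinearIsometry.norm_map]

theorem isAlmostInvariant_norm_convolve [DecidableEq F] (ι : F →* G) {r : Fin n → F →₀ ℂ}
    {i : Fin n} {s k : F} (hs : s ≠ 1) (hr : (r i).support = {k, s⁻¹ * k}) (ξ : L2 G) :
    IsAlmostInvariant (fun A => ‖L2.restrict A ξ‖) (2 * ‖r i k‖⁻¹ * ‖convolve ι r ξ‖) (ι s) := by
  have hk : r i k ≠ 0 := Finsupp.mem_support_iff.1 (by simp [hr])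
  have hne : k ≠ s⁻¹ * k := fun h => hs (by simpa using h)
  have hk' : (ι (s⁻¹ * k))⁻¹ = (ι k)⁻¹ * ι s := by
    rw [map_mul, map_inv, mul_inv_rev, inv_inv]
  have hcoord : convolve ι r ξ i = L2.rightTranslate (ι k)⁻¹
      (r i k • ξ + r i (s⁻¹ * k) • L2.rightTranslate (ι s) ξ) := by
    rw [convolve_coord, Finsupp.sum, hr, Finset.sum_pair hne, map_add, map_smul, map_smul,
      ← L2.rightTranslate_mul, ← hk']
  refine (L2.isAlmostInvariant_norm_restrict hk (r i (s⁻¹ * k)) (ι s) ξ).mono ?_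
  rw [← LinearIsometry.norm_map (L2.rightTranslate (ι k)⁻¹), ← hcoord]
  gcongr
  exact PiLp.norm_apply_le _ i

theorem exists_antilipschitzWith_convolve_of_singleton (ι : F →* G) {r : Fin n → F →₀ ℂ}
    (hr : ∃ i k, (r i).support = {k}) : ∃ K, AntilipschitzWith K (convolve ι r) := by
  obtain ⟨i, k, hik⟩ := hr
  have hk : r i k ≠ 0 := Finsupp.mem_support_iff.1 (by simp [hik])
  refine ⟨‖r i k‖₊⁻¹, AddMonoidHomClass.antilipschitz_of_bound _ fun ξ => ?_⟩
  rw [NNReal.coe_inv, coe_nnnorm, le_inv_mul_iff₀ (norm_pos_iff.2 hk)]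
  exact norm_mul_le_norm_convolve ι hik ξ

theorem exists_antilipschitzWith_convolve_of_pairs [IsFreeGroup F] [DecidableEq F] {ι : F →* G}
    (hι : Function.Injective ι) {r : Fin n → F →₀ ℂ} {s t : F} (hst : ¬ Commute s t)
    (hs : ∃ i k, (r i).support = {k, s⁻¹ * k}) (ht : ∃ i k, (r i).support = {k, t⁻¹ * k}) :
    ∃ K, AntilipschitzWith K (convolve ι r) := by
  obtain ⟨⟨i, k, hik⟩, j, l, hjl⟩ := hs, ht
  have hs1 : s ≠ 1 := fun h => hst (h ▸ Commute.one_left t)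
  have ht1 : t ≠ 1 := fun h => hst (h ▸ Commute.one_right s)
  obtain ⟨C, hC⟩ := L2.exists_norm_le_of_isAlmostInvariant hι hst
  let B : ℝ≥0 := 2 * (‖r i k‖₊⁻¹ ⊔ ‖r j l‖₊⁻¹)
  refine ⟨C * B, AddMonoidHomClass.antilipschitz_of_bound _ fun ξ => ?_⟩
  rw [NNReal.coe_mul, mul_assoc]
  refine hC ξ _ ((isAlmostInvariant_norm_convolve ι hs1 hik ξ).mono ?_)
    ((isAlmostInvariant_norm_convolve ι ht1 hjl ξ).mono ?_) <;>
  · push_cast [B]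
    gcongr
    simp

end L2n

/-! ### Nielsen 1-chains -/

namespace CellGraph

variable {V E : Type*} {Γ : CellGraph V E} {a : V} {H : Γ.Subgraph} {n : ℕ}

theorem translate_apply (g : Γ.π₁ a) (x : Γ.Chain₁ a) (e : Γ.CoverEdge a) :
    translate g x e = x (g⁻¹ • e) := by
  conv_lhs => rw [← smul_inv_smul g e]
  exact Finsupp.mapDomain_apply (MulAction.injective g) x _

theorem translate_one (x : Γ.Chain₁ a) : translate 1 x = x := by
  ext e
  rw [translate_apply, inv_one, one_smul]

theorem IsGeometric.inter_eq_singleton {ρ : Γ.Chain₁ a} (h : IsGeometric H ρ) {g₁ g₂ : Γ.π₁ a}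
    (hne : g₁ ≠ g₂) {e : Γ.CoverEdge a} (h₁ : e ∈ supp (translate g₁ ρ))
    (h₂ : e ∈ supp (translate g₂ ρ)) :
    supp (translate g₁ ρ) ∩ supp (translate g₂ ρ) = {e} := by
  have he : e ∈ supp (translate g₁ ρ) ∩ supp (translate g₂ ρ) := ⟨h₁, h₂⟩
  obtain hempty | ⟨e', he'⟩ := h.single g₁ g₂ hne
  · exact absurd he (hempty ▸ Set.notMem_empty e)
  · rw [he'] at he ⊢
    rw [Set.mem_singleton_iff.1 he]

theorem IsGeometric.exists_forall_mem_supp_translate_iff {ρ : Γ.Chain₁ a}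
    (h : IsGeometric H ρ) (hρ : ρ ∈ relChains a H) {s : Γ.π₁ a} (hs : s ≠ 1)
    (hne : (supp ρ ∩ supp (translate s ρ)).Nonempty) :
    ∃ e ∈ outside a H, ∀ k : Γ.π₁ a, e ∈ supp (translate k ρ) ↔ k = 1 ∨ k = s := by
  obtain ⟨e, he, hes⟩ := hne
  have hout : e ∈ outside a H := hρ (Finsupp.mem_support_iff.2 he)
  rw [← translate_one ρ] at he
  refine ⟨e, hout, fun k => ⟨fun hek => ?_, by rintro (rfl | rfl) <;> assumption⟩⟩
  by_contra! hk
  obtain ⟨g₁, g₂, -, -, huniq⟩ := h.pair e hout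
  have hpair_s := huniq 1 s hs.symm (h.inter_eq_singleton hs.symm he hes)
  have hpair_k := huniq 1 k hk.1.symm (h.inter_eq_singleton hk.1.symm he hek)
  grind

theorem EdgeBasis.exists_smul_eq (b : EdgeBasis Γ a H n) {e : Γ.CoverEdge a}
    (he : e ∈ outside a H) : ∃ (i : Fin n) (k : Γ.π₁ a), k • b.edge i = e := by
  obtain ⟨i, -, hi⟩ := b.bijOn.surjOn he
  have hi : (b.edge i).1.1 = e.1.1 := hi
  have hb : (b.edge i).1.2 ∈ Γ.PathClass a (Γ.o e.1.1) := by rw [← hi]; exact (b.edge i).2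
  refine ⟨i, ⟨e.1.2 * (b.edge i).1.2⁻¹, PathClass.mul_mem e.2 (PathClass.inv_mem hb)⟩, ?_⟩
  exact Subtype.ext (Prod.ext hi (inv_mul_cancel_right _ _))

/-- The coordinates of a 1-chain with respect to a basis of edges, as finitely supported
functions; `EdgeBasis.coord` is the same tuple in `L²(F)ⁿ`. -/
noncomputable def EdgeBasis.coeffs (b : EdgeBasis Γ a H n) (x : Γ.Chain₁ a) (i : Fin n) :
    Γ.π₁ a →₀ ℂ :=
  (x.comapDomain (fun g : Γ.π₁ a => g • b.edge i)
    (CoverEdge.smul_left_injective (b.edge i)).injOn).mapRange (fun q : ℚ => (q : ℂ)) Rat.cast_zero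

theorem EdgeBasis.coeffs_apply (b : EdgeBasis Γ a H n) (x : Γ.Chain₁ a) (i : Fin n)
    (g : Γ.π₁ a) : b.coeffs x i g = ((x (g • b.edge i) : ℚ) : ℂ) := rfl

theorem EdgeBasis.exists_mem_support_coeffs_iff (b : EdgeBasis Γ a H n) (x : Γ.Chain₁ a)
    {e : Γ.CoverEdge a} (he : e ∈ outside a H) :
    ∃ (i : Fin n) (k : Γ.π₁ a), ∀ g, g ∈ (b.coeffs x i).support ↔ x ((g * k⁻¹) • e) ≠ 0 := by
  obtain ⟨i, k, rfl⟩ := b.exists_smul_eq he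
  refine ⟨i, k, fun g => ?_⟩
  rw [Finsupp.mem_support_iff, b.coeffs_apply, smul_smul, inv_mul_cancel_right, Rat.cast_ne_zero]

theorem IsNonGeometric.exists_support_coeffs_eq_singleton {ρ : Γ.Chain₁ a}
    (h : IsNonGeometric H ρ) (b : EdgeBasis Γ a H n) :
    ∃ i k, (b.coeffs ρ i).support = {k} := by
  obtain ⟨e, he, hρe, hzero⟩ := h
  obtain ⟨i, k, hik⟩ := b.exists_mem_support_coeffs_iff ρ he
  refine ⟨i, k, Finset.ext fun g => ?_⟩
  rw [hik, Finset.mem_singleton, ← mul_inv_eq_one]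
  refine ⟨not_imp_comm.1 (hzero (g * k⁻¹)), fun hg => ?_⟩
  rw [hg, one_smul]
  rcases hρe with hρe | hρe <;> simp [hρe]

theorem IsGeometric.exists_support_coeffs_eq_pair [DecidableEq (Γ.π₁ a)] {ρ : Γ.Chain₁ a}
    (h : IsGeometric H ρ) (hρ : ρ ∈ relChains a H) (b : EdgeBasis Γ a H n) {s : Γ.π₁ a}
    (hs : s ≠ 1) (hne : (supp ρ ∩ supp (translate s ρ)).Nonempty) :
    ∃ i k, (b.coeffs ρ i).support = {k, s⁻¹ * k} := by
  obtain ⟨e, he, hmem⟩ := h.exists_forall_mem_supp_translate_iff hρ hs hne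
  obtain ⟨i, k, hik⟩ := b.exists_mem_support_coeffs_iff ρ he
  refine ⟨i, k, Finset.ext fun g => ?_⟩
  have hg : ρ ((g * k⁻¹) • e) = translate (k * g⁻¹) ρ e := by
    rw [translate_apply, mul_inv_rev, inv_inv]
  rw [hik, hg, Finset.mem_insert, Finset.mem_singleton]
  refine (hmem (k * g⁻¹)).trans (or_congr ?_ ?_)
  · rw [mul_inv_eq_one, eq_comm]
  · rw [mul_inv_eq_iff_eq_mul, eq_inv_mul_iff_mul_eq, eq_comm]

theorem exists_antilipschitzWith_convolve {ρ : Γ.Chain₁ a} (hρ : ρ ∈ relChains a H)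
    (h : IsNonGeometric H ρ ∨ IsGeometric H ρ) (b : EdgeBasis Γ a H n) {G : Type*} [Group G]
    {ι : Γ.π₁ a →* G} (hι : Function.Injective ι) :
    ∃ K, AntilipschitzWith K (L2n.convolve ι (b.coeffs ρ)) := by
  classical
  rcases h with h | h
  · exact L2n.exists_antilipschitzWith_convolve_of_singleton ι
      (h.exists_support_coeffs_eq_singleton b)
  · obtain ⟨s, t, hst, hs, ht⟩ := h.noncommuting
    refine L2n.exists_antilipschitzWith_convolve_of_pairs hι hst
      (h.exists_support_coeffs_eq_pair hρ b ?_ hs) (h.exists_support_coeffs_eq_pair hρ b ?_ ht)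
    · exact fun hs1 => hst (hs1 ▸ Commute.one_left t)
    · exact fun ht1 => hst (ht1 ▸ Commute.one_right s)

/-! ### The modules as closed ranges -/

theorem EdgeBasis.coord_apply (b : EdgeBasis Γ a H n) (x : Γ.Chain₁ a) (i : Fin n)
    (g : Γ.π₁ a) : b.coord x i g = ((x (g • b.edge i) : ℚ) : ℂ) := rfl

theorem EdgeBasis.coord_zero (b : EdgeBasis Γ a H n) : b.coord 0 = 0 := by
  ext i g
  simp [b.coord_apply]

theorem EdgeBasis.coord_add (b : EdgeBasis Γ a H n) (x y : Γ.Chain₁ a) :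
    b.coord (x + y) = b.coord x + b.coord y := by
  ext i g
  simp [b.coord_apply]

theorem EdgeBasis.coord_smul (b : EdgeBasis Γ a H n) (c : ℚ) (x : Γ.Chain₁ a) :
    b.coord (c • x) = (c : ℂ) • b.coord x := by
  ext i g
  simp [b.coord_apply]

theorem EdgeBasis.convolve_single [DecidableEq (Γ.π₁ a)] (b : EdgeBasis Γ a H n)
    (x : Γ.Chain₁ a) (g : Γ.π₁ a) :
    L2n.convolve (MonoidHom.id _) (b.coeffs x) (lp.single 2 g 1) = b.coord (translate g x) := by
  ext i y
  have hsingle (k : Γ.π₁ a) : (lp.single 2 g (1 : ℂ) : L2 (Γ.π₁ a)) (y * k⁻¹) =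
      if k = g⁻¹ * y then 1 else 0 := by
    rw [lp.single_apply, Pi.single_apply]
    refine if_congr ?_ rfl rfl
    rw [mul_inv_eq_iff_eq_mul, eq_inv_mul_iff_mul_eq, eq_comm]
  rw [L2n.convolve_apply, b.coord_apply, translate_apply, smul_smul, ← b.coeffs_apply]
  simp only [MonoidHom.id_apply, hsingle, mul_ite, mul_one, mul_zero, Finsupp.sum_ite_self_eq']

theorem span_coord_eq_span_translate (b : EdgeBasis Γ a H n)
    {U : Submodule ℚ (Γ.Chain₁ a)} (hU : ∀ (g : Γ.π₁ a), ∀ x ∈ U, translate g x ∈ U)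
    {ρ : Γ.Chain₁ a} (hρ : Generates ρ U) :
    Submodule.span ℂ (b.coord '' U) =
      Submodule.span ℂ (Set.range fun g : Γ.π₁ a => b.coord (translate g ρ)) := by
  refine le_antisymm (Submodule.span_le.2 ?_) (Submodule.span_mono ?_)
  · rintro _ ⟨x, hx, rfl⟩
    obtain ⟨q, rfl⟩ := hρ.2 x hx
    have hsum : b.coord (q.sum fun g c => c • translate g ρ) =
        q.sum fun g c => (c : ℂ) • b.coord (translate g ρ) :=
      (map_finsuppSum (AddMonoidHom.mk' b.coord b.coord_add) q _).trans
        (Finsupp.sum_congr fun g _ => b.coord_smul _ _)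
    rw [hsum]
    exact sum_mem fun g _ => Submodule.smul_mem _ _ (Submodule.subset_span ⟨g, rfl⟩)
  · rintro _ ⟨g, rfl⟩
    exact ⟨_, hU g ρ hρ.1, rfl⟩

theorem hilbert_eq_topologicalClosure_range (b : EdgeBasis Γ a H n)
    {U : Submodule ℚ (Γ.Chain₁ a)} (hU : ∀ (g : Γ.π₁ a), ∀ x ∈ U, translate g x ∈ U)
    {ρ : Γ.Chain₁ a} (hρ : Generates ρ U) :
    hilbert b U = (L2n.convolve (MonoidHom.id _) (b.coeffs ρ)).range.topologicalClosure := by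
  classical
  rw [hilbert, span_coord_eq_span_translate b hU hρ, L2.topologicalClosure_range_eq_span_single]
  simp only [b.convolve_single]

theorem hilbert_bot (b : EdgeBasis Γ a H n) : hilbert b (⊥ : Submodule ℚ (Γ.Chain₁ a)) = ⊥ := by
  rw [hilbert, Submodule.bot_coe, Set.image_singleton, b.coord_zero, Submodule.span_zero_singleton]
  exact isClosed_singleton.submodule_topologicalClosure_eq

end CellGraph

theorem FreeByCyclic.exists_eq_zpow_mul_inl {F : Type*} [Group F] (Φ : MulAut F)
    (x : FreeByCyclic Φ) :
    ∃ (ℓ : ℤ) (g : F), x = FreeByCyclic.t Φ ^ ℓ * SemidirectProduct.inl g := by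
  refine ⟨x.right.toAdd, (zpowersHom (MulAut F) Φ⁻¹ x.right)⁻¹ x.left, ?_⟩
  have ht : FreeByCyclic.t Φ ^ x.right.toAdd = SemidirectProduct.inr x.right := by
    rw [FreeByCyclic.t, ← map_zpow, ← ofAdd_zsmul]
    simp
  rw [ht]
  ext <;> simp

theorem inducedModule_bot {F : Type*} [Group F] (Φ : MulAut F) (n : ℕ) :
    inducedModule Φ (⊥ : Submodule ℂ (L2n F n)) = ⊥ := by
  simp only [inducedModule, Submodule.map_bot, iSup_bot]
  exact isClosed_singleton.submodule_topologicalClosure_eq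

theorem inducedModule_range_convolve {F : Type*} [Group F] (Φ : MulAut F) {n : ℕ}
    (r : Fin n → F →₀ ℂ) :
    inducedModule Φ (L2n.convolve (MonoidHom.id F) r).range =
      (L2n.convolve (SemidirectProduct.inl : F →* FreeByCyclic Φ) r).range.topologicalClosure := by
  classical
  have hinl := SemidirectProduct.inl_injective (φ := zpowersHom (MulAut F) Φ⁻¹)
  have hact (ℓ : ℤ) (ξ : L2 F) : L2n.convolve SemidirectProduct.inl r
      (L2.act (FreeByCyclic.t Φ ^ ℓ) (L2.ext _ hinl ξ)) = L2n.act (FreeByCyclic.t Φ ^ ℓ)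
        (L2n.mapCoord (L2.ext _ hinl) (L2n.convolve (MonoidHom.id F) r ξ)) := by
    rw [L2n.convolve_act, L2n.convolve_ext]
  apply le_antisymm
  · refine Submodule.topologicalClosure_mono (iSup_le fun ℓ => ?_)
    rintro _ ⟨_, ⟨_, ⟨ξ, rfl⟩, rfl⟩, rfl⟩
    exact ⟨_, hact ℓ ξ⟩
  · rw [L2.topologicalClosure_range_eq_span_single]
    refine Submodule.topologicalClosure_mono (Submodule.span_le.2 ?_)
    rintro _ ⟨x, rfl⟩
    obtain ⟨ℓ, g, rfl⟩ := FreeByCyclic.exists_eq_zpow_mul_inl Φ x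
    dsimp only
    rw [← L2.act_single, ← L2.ext_single hinl, hact]
    exact Submodule.mem_iSup_of_mem ℓ
      (Submodule.mem_map_of_mem (Submodule.mem_map_of_mem ⟨_, rfl⟩))

section BoundedBelow

variable {𝕜 X Y : Type*} [NontriviallyNormedField 𝕜] [NormedAddCommGroup X] [NormedSpace 𝕜 X]
  [NormedAddCommGroup Y] [NormedSpace 𝕜 Y]

theorem topologicalClosure_range_eq_of_antilipschitzWith [CompleteSpace X] {T : X →L[𝕜] Y}
    {K : ℝ≥0} (hT : AntilipschitzWith K T) : T.range.topologicalClosure = T.range :=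
  (hT.isClosed_range T.uniformContinuous).submodule_topologicalClosure_eq

theorem exists_continuousLinearEquiv_of_antilipschitzWith [CompleteSpace X] [CompleteSpace Y]
    {T : X →L[𝕜] Y} {K : ℝ≥0} (hT : AntilipschitzWith K T) {P : Submodule 𝕜 Y}
    (hP : P = T.range.topologicalClosure) : ∃ O : X ≃L[𝕜] P, ∀ x, (O x : Y) = T x := by
  obtain rfl : P = T.range := hP.trans (topologicalClosure_range_eq_of_antilipschitzWith hT)
  exact ⟨T.equivRange hT.injective (hT.isClosed_range T.uniformContinuous), fun _ => rfl⟩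

theorem exists_inv_mul_norm_le_and_norm_le (O : X ≃L[𝕜] Y) :
    ∃ D : ℝ, 1 ≤ D ∧ ∀ x, D⁻¹ * ‖x‖ ≤ ‖O x‖ ∧ ‖O x‖ ≤ D * ‖x‖ := by
  let D := max 1 (max ‖(O : X →L[𝕜] Y)‖ ‖(O.symm : Y →L[𝕜] X)‖)
  have hD : 0 < D := zero_lt_one.trans_le (le_max_left _ _)
  refine ⟨D, le_max_left _ _, fun x => ⟨?_, ?_⟩⟩
  · rw [inv_mul_le_iff₀ hD]
    calc ‖x‖ = ‖(O.symm : Y →L[𝕜] X) (O x)‖ := by simp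
      _ ≤ D * ‖O x‖ := (O.symm : Y →L[𝕜] X).le_of_opNorm_le
          ((le_max_right _ _).trans (le_max_right _ _)) _
  · exact (O : X →L[𝕜] Y).le_of_opNorm_le ((le_max_left _ _).trans (le_max_right _ _)) x

end BoundedBelow

theorem mainTheorem5_general {V E : Type*} {Γ : CellGraph V E} {a : V} {H : Γ.Subgraph} {n : ℕ}
    [DecidableEq (Γ.π₁ a)] (b : CellGraph.EdgeBasis Γ a H n) {U : Submodule ℚ (Γ.Chain₁ a)}
    (hrel : U ≤ CellGraph.relChains a H)
    (htranslate : ∀ (g : Γ.π₁ a), ∀ x ∈ U, CellGraph.translate g x ∈ U)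
    (hgen : U ≠ ⊥ → ∃ ρ, (CellGraph.IsNonGeometric H ρ ∨ CellGraph.IsGeometric H ρ) ∧
      CellGraph.Generates ρ U)
    (Φ : MulAut (Γ.π₁ a)) :
    (inducedModule Φ (CellGraph.hilbert b U) ≠ ⊥ →
      ∃ O : L2 (FreeByCyclic Φ) ≃L[ℂ] inducedModule Φ (CellGraph.hilbert b U),
        ∀ g ξ, (O (L2.act g ξ) : L2n (FreeByCyclic Φ) n) = L2n.act g (O ξ)) ∧
    ∀ ρ : Γ.Chain₁ a, (CellGraph.IsNonGeometric H ρ ∨ CellGraph.IsGeometric H ρ) →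
      CellGraph.Generates ρ U →
      ∃ O : L2 (Γ.π₁ a) ≃L[ℂ] CellGraph.hilbert b U,
        (∀ g, (O (lp.single 2 g (1 : ℂ)) : L2n (Γ.π₁ a) n) =
          b.coord (CellGraph.translate g ρ)) ∧
        (∀ g ξ, (O (L2.act g ξ) : L2n (Γ.π₁ a) n) = L2n.act g (O ξ)) ∧
        ∃ D : ℝ, 1 ≤ D ∧ ∀ ξ, D⁻¹ * ‖ξ‖ ≤ ‖O ξ‖ ∧ ‖O ξ‖ ≤ D * ‖ξ‖ := by
  refine ⟨fun hW => ?_, fun ρ hρ hρU => ?_⟩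
  · have hU : U ≠ ⊥ := by
      rintro rfl
      exact hW (by rw [CellGraph.hilbert_bot, inducedModule_bot])
    obtain ⟨ρ, hρ, hρU⟩ := hgen hU
    obtain ⟨K, hK⟩ := CellGraph.exists_antilipschitzWith_convolve (hrel hρU.1) hρ b
      (ι := MonoidHom.id _) Function.injective_id
    obtain ⟨K', hK'⟩ := CellGraph.exists_antilipschitzWith_convolve (hrel hρU.1) hρ b
      (ι := (SemidirectProduct.inl : _ →* FreeByCyclic Φ)) SemidirectProduct.inl_injective
    have hV := CellGraph.hilbert_eq_topologicalClosure_range b htranslate hρU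
    rw [topologicalClosure_range_eq_of_antilipschitzWith hK] at hV
    obtain ⟨O, hO⟩ := exists_continuousLinearEquiv_of_antilipschitzWith hK'
      ((congrArg (inducedModule Φ) hV).trans (inducedModule_range_convolve Φ _))
    exact ⟨O, fun g ξ => by rw [hO, hO, L2n.convolve_act]⟩
  · obtain ⟨K, hK⟩ := CellGraph.exists_antilipschitzWith_convolve (hrel hρU.1) hρ b
      (ι := MonoidHom.id _) Function.injective_id
    obtain ⟨O, hO⟩ := exists_continuousLinearEquiv_of_antilipschitzWith hK
      (CellGraph.hilbert_eq_topologicalClosure_range b htranslate hρU)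
    exact ⟨O, fun g => by rw [hO, b.convolve_single],
      fun g ξ => by rw [hO, hO, L2n.convolve_act], exists_inv_mul_norm_le_and_norm_le O⟩


open Classical in
theorem mainTheorem5 {V E : Type*} [Finite V] [Finite E]
    (Γ : CellGraph V E) (hΓ : Γ.Connected)
    (f : Γ.SelfMap) (hf : f.IsHomotopyEquivalence)
    (a : V) (ha : f.onV a = a)
    (H : Γ.Subgraph) (hH : f.Preserves H)
    (n : ℕ) (b : CellGraph.EdgeBasis Γ a H n)
    (Vqf : Submodule ℚ (Γ.Chain₁ a)) (hVqf : CellGraph.IsQuasiFixed f ha H Vqf) :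
    (inducedModule (f.inducedAut hf ha) (CellGraph.hilbert b Vqf) ≠ ⊥ →
      ∃ O : L2 (FreeByCyclic (f.inducedAut hf ha)) ≃L[ℂ]
          inducedModule (f.inducedAut hf ha) (CellGraph.hilbert b Vqf),
        ∀ g ξ, (O (L2.act g ξ) : L2n (FreeByCyclic (f.inducedAut hf ha)) n) =
          L2n.act g (O ξ)) ∧
    ∀ ρ : Γ.Chain₁ a, CellGraph.IsNielsen f ha H ρ → CellGraph.Generates ρ Vqf →
      ∃ O : L2 (Γ.π₁ a) ≃L[ℂ] CellGraph.hilbert b Vqf,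
        (∀ g, (O (lp.single 2 g (1 : ℂ)) : L2n (Γ.π₁ a) n) =
          b.coord (CellGraph.translate g ρ)) ∧
        (∀ g ξ, (O (L2.act g ξ) : L2n (Γ.π₁ a) n) = L2n.act g (O ξ)) ∧
        ∃ D : ℝ, 1 ≤ D ∧ ∀ ξ, D⁻¹ * ‖ξ‖ ≤ ‖O ξ‖ ∧ ‖O ξ‖ ≤ D * ‖ξ‖ := by
  exact (mainTheorem5_general b hVqf.le_rel hVqf.translate_mem
    (fun h => (hVqf.generated h).imp fun _ => .imp_left And.right) _).imp_right
    fun h ρ hρ => h ρ hρ.2
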